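/- Let $M$ be a loopless oriented matroid on a finite ground set $E$, given by its set $\mathcal L\subset\{0,+,-\}^E$ of covectors; its flats are the zero sets of covectors, and its set $\mathcal T$ of topes is the set of maximal covectors (they lie in $\{+,-\}^E$). For $\mathbf v\in\mathbb F_2^E$ let $T_{\mathbf v}\in\{+,-\}^E$ be given by $(T_{\mathbf v})_e=(-1)^{\mathbf v_e}$. *Dual Varchenko–Gelfand filtration.* For $e\in E$ let $h_e:\mathcal T\to\mathbb Z$ be $1$ on topes $T$ with $T_e=+$ and $0$ on topes with $T_e=-$. The degree of a nonzero function $f:\mathcal T\to\mathbb Z$ is the least degree of an integer polynomial in the $h_e$ that represents $f$; the zero function has degree $-1$. For $p\ge 0$ let $\mathcal P_p(M)\subset\mathbb Z[\mathcal T]$ be the group of all $\gamma=\sum_T c_T T$ such that $\sum_T c_T f(T)=0$ for all $f$ of degree at most $p-1$, and let $\overline{\mathcal P}_p(M)\subset\mathbb F_2[\mathcal T]$ be its reduction mod $2$. *Quillen filtration.* For a vector space $V$ over $\mathbb F_2$ let $\mathcal I_p(V)$ be the $p$-th power of the augmentation ideal of the group algebra $\mathbb F_2[V]$ (with $\mathcal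 I_0(V)=\mathbb F_2[V]$). For a complete flag of flats $\mathcal F:\emptyset=F_0\subsetneq F_1\subsetneq\dots\subsetneq F_d=E$ let $\mathcal T_{\mathcal F}$ be the set of topes $T$ such that for every $i$ the sign vector obtained from $T$ by setting all coordinates in $F_i$ to $0$ is a covector. Under $\mathbf v\mapsto T_{\mathbf v}$ the set $\mathcal T_{\mathcal F}$ is an affine subspace of $\mathbb F_2^E$, parallel to the span of the linearly independent vectors $\mathbf d_i=\mathbf e_{F_i\setminus F_{i-1}}$, $i=1,\dots,d$. Choosing an origin identifies it with a vector space and defines $\mathcal I_p(\mathcal T_{\mathcal F})\subset\mathbb F_2[\mathcal T_{\mathcal F}]\subset\mathbb F_2[\mathcal T]$, independently of the origin. Put $\mathcal Q_p(M)=\sum_{\mathcal F}\mathcal I_p(\mathcal T_{\mathcal F})$, the sum over all complete flags of flats of $M$. Then for every integer $p\ge 0$: 1. $\mathcal Q_p(M)\subset\overline{\mathcal P}_p(M)$. 2. For every complete flag of flats $\mathcal F$, every $T_{\mathbf v}\in\mathcal T_{\mathcal F}$ and every $S\subset\{1,\dots,d\}$ with $|S|=p$, the affine coordinate chain $\sum_{A\subset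 S}(-1)^{|A|}\,T_{\mathbf v+\sum_{i\in A}\mathbf d_i}\in\mathbb Z[\mathcal T]$ lies in $\mathcal P_p(M)$. 3. Let $V$ be a vector space over $\mathbb F_2$ with a finite basis. An affine coordinate subspace of dimension $p$ is a translate of the span of $p$ of the basis vectors, and for $G\subset V$ let $\gamma_G=\sum_{\mathbf v\in G}T_{\mathbf v}\in\mathbb F_2[V]$. Then $\mathcal I_p(V)$ is contained in the $\mathbb F_2$-span of the elements $\gamma_U$, where $U$ ranges over the affine coordinate subspaces of dimension $p$. Moreover $\gamma_{V'}$ lies in this span for every $p$-dimensional linear subspace $V'$ of $V$. -/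

import Mathlib

noncomputable section

/-! ### Sign vectors -/

/-- The composition `X ∘ Y` of sign vectors: `X` where it is nonzero, and `Y` elsewhere. -/
def signComp {E : Type*} (X Y : E → SignType) : E → SignType :=
  fun e => if X e = 0 then Y e else X e

/-- The separation set of two sign vectors: the positions where they have opposite nonzero
signs. -/
def signSep {E : Type*} (X Y : E → SignType) : Set E :=
  {e | X e ≠ 0 ∧ Y e = -X e}

/-- The partial order on sign vectors generated coordinatewise by `0 < +` and `0 < -`
(this is not the linear order `- < 0 < +` on `SignType`). -/
def signLE {E : Type*} (X Y : E → SignType) : Prop :=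
  ∀ e, X e = 0 ∨ X e = Y e

open Classical in
/-- The sign vector `T ∖ F`: all coordinates of `T` in `F` are set to zero. -/
def signDelete {E : Type*} (T : E → SignType) (F : Set E) : E → SignType :=
  fun e => if e ∈ F then 0 else T e

/-- The sign vector `T_v` of a vector `v` over the field with two elements,
`(T_v)_e = (-1) ^ (v_e)`. One has `T_(u+v) = T_u * T_v`, with coordinatewise product. -/
def signVec {E : Type*} (v : E → ZMod 2) : E → SignType :=
  fun e => (-1) ^ (v e).val

/-! ### Oriented matroids, described by covectors -/

/-- An oriented matroid on the ground set `E`, given by its covectors. -/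
structure OrientedMatroid (E : Type*) where
  covectors : Set (E → SignType)
  zero_mem : (0 : E → SignType) ∈ covectors
  neg_mem : ∀ X ∈ covectors, -X ∈ covectors
  comp_mem : ∀ X ∈ covectors, ∀ Y ∈ covectors, signComp X Y ∈ covectors
  elimination : ∀ X ∈ covectors, ∀ Y ∈ covectors, ∀ e ∈ signSep X Y,
    ∃ Z ∈ covectors, Z e = 0 ∧ ∀ f, f ∉ signSep X Y → Z f = signComp X Y f

namespace OrientedMatroid

variable {E : Type*} (M : OrientedMatroid E)

/-- A loop is an element on which every covector vanishes; `M` is loopless if it has none. -/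
def Loopless : Prop := ∀ e, ∃ X ∈ M.covectors, X e ≠ 0

/-- The flats of (the underlying matroid of) `M` are the complements of the supports of the
covectors. -/
def IsFlat (F : Set E) : Prop := ∃ X ∈ M.covectors, F = {e | X e = 0}

/-- The topes are the maximal covectors. -/
def IsTope (T : E → SignType) : Prop :=
  T ∈ M.covectors ∧ ∀ Y ∈ M.covectors, signLE T Y → Y = T

/-- The type of topes of `M`. -/
def Tope : Type _ := {T : E → SignType // M.IsTope T}

/-- The tope space of `M` over `R`: the free `R`-module on the topes. -/
abbrev TopeSpace (R : Type*) [Semiring R] : Type _ := M.Tope →₀ R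

/-- A complete flag of flats `∅ = F_0 < F_1 < ... < F_d = E`: a chain of flats from `∅` to `E`
that cannot be refined. -/
structure CompleteFlag where
  length : ℕ
  flat : Fin (length + 1) → Set E
  isFlat : ∀ i, M.IsFlat (flat i)
  flat_zero : flat 0 = ∅
  flat_last : flat (Fin.last length) = Set.univ
  ssubset : ∀ i : Fin length, flat i.castSucc ⊂ flat i.succ
  saturated : ∀ (i : Fin length) (G : Set E), M.IsFlat G →
    flat i.castSucc ⊆ G → G ⊆ flat i.succ → G = flat i.castSucc ∨ G = flat i.succ

variable {M}

namespace CompleteFlag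

variable (𝓕 : M.CompleteFlag)

/-- The set `T_𝓕` of topes adjacent to the flag `𝓕`: the topes `T` such that `T ∖ F_i` is a
covector for every flat `F_i` of the flag. -/
def topes : Set (E → SignType) :=
  {T | M.IsTope T ∧ ∀ i, signDelete T (𝓕.flat i) ∈ M.covectors}

open Classical in
/-- The vector `d_i`, the indicator vector of the `i`-th block `F_i ∖ F_(i-1)` of the flag
(blocks are counted from zero here). -/
def blockVec (i : Fin 𝓕.length) : E → ZMod 2 :=
  fun e => if e ∈ 𝓕.flat i.succ ∧ e ∉ 𝓕.flat i.castSucc then 1 else 0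

end CompleteFlag

end OrientedMatroid

/-! ### `T_𝓕` is an affine space over the field with two elements -/

theorem signVec_zero {E : Type*} : signVec (0 : E → ZMod 2) = 1 := by
  funext e; simp [signVec]

theorem signVec_add {E : Type*} (u v : E → ZMod 2) :
    signVec (u + v) = signVec u * signVec v := by
  funext e
  have key : ∀ a b : ZMod 2, ((-1 : SignType)) ^ (a + b).val = (-1) ^ a.val * (-1) ^ b.val := by
    decide
  exact key (u e) (v e)

theorem signVec_mul_self {E : Type*} (u : E → ZMod 2) : signVec u * signVec u = 1 := by
  funext e
  have key : ∀ a : ZMod 2, ((-1 : SignType)) ^ a.val * (-1) ^ a.val = 1 := by decide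
  exact key (u e)

namespace OrientedMatroid

variable {E : Type*} {M : OrientedMatroid E}

namespace CompleteFlag

variable (𝓕 : M.CompleteFlag)

theorem mono : Monotone 𝓕.flat :=
  Fin.monotone_iff_le_succ.2 fun i => (𝓕.ssubset i).subset

theorem ne_zero_of_isTope (𝓕 : M.CompleteFlag) {T : E → SignType} (hT : M.IsTope T) (e : E) : T e ≠ 0 := by
  intro h0
  obtain ⟨X, hX, hX0⟩ := 𝓕.isFlat 0
  rw [𝓕.flat_zero] at hX0
  have h1 := hT.2 (signComp T X) (M.comp_mem _ hT.1 _ hX) (fun e => by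
    by_cases h : T e = 0 <;> simp [signComp, h])
  have h2 := congrFun h1 e
  have h3 : X e = 0 := by simpa [signComp, h0] using h2
  have : e ∈ (∅ : Set E) := by rw [hX0]; exact h3
  exact this

theorem isTope_of_ne_zero {T : E → SignType} (hT : T ∈ M.covectors) (h : ∀ e, T e ≠ 0) :
    M.IsTope T :=
  ⟨hT, fun _ _ hY => funext fun e => ((hY e).resolve_left (h e)).symm⟩

open Classical in
/-- The indicator vector `f_i` of the `i`-th flat of the flag. -/
def flatVec (i : Fin (𝓕.length + 1)) : E → ZMod 2 :=
  fun e => if e ∈ 𝓕.flat i then 1 else 0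

theorem signVec_flatVec (i : Fin (𝓕.length + 1)) (T : E → SignType) (e : E) :
    (signVec (𝓕.flatVec i) * T) e = open Classical in if e ∈ 𝓕.flat i then - T e else T e := by
  by_cases h : e ∈ 𝓕.flat i
  · have : ((1 : ZMod 2)).val = 1 := rfl
    simp [signVec, flatVec, h, this]
  · simp [signVec, flatVec, h]

/-- `T_𝓕` is stable under reversing all signs on a flat of the flag. -/
theorem flatVec_mul_mem {T : E → SignType} (hT : T ∈ 𝓕.topes) (i : Fin (𝓕.length + 1)) :
    signVec (𝓕.flatVec i) * T ∈ 𝓕.topes := by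
  have hne := 𝓕.ne_zero_of_isTope hT.1
  have hcov : signVec (𝓕.flatVec i) * T ∈ M.covectors := by
    have : signVec (𝓕.flatVec i) * T = signComp (signDelete T (𝓕.flat i)) (-T) := by
      funext e
      rw [signVec_flatVec]
      by_cases h : e ∈ 𝓕.flat i <;> simp [signComp, signDelete, h, hne]
    rw [this]
    exact M.comp_mem _ (hT.2 i) _ (M.neg_mem _ hT.1.1)
  refine ⟨isTope_of_ne_zero hcov fun e => ?_, fun j => ?_⟩
  · rw [signVec_flatVec]
    by_cases h : e ∈ 𝓕.flat i <;> simp [h, hne]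
  · have : signDelete (signVec (𝓕.flatVec i) * T) (𝓕.flat j) =
        signComp (signDelete T (𝓕.flat i ∪ 𝓕.flat j)) (-(signDelete T (𝓕.flat j))) := by
      funext e
      simp only [signDelete, signComp, signVec_flatVec, Pi.neg_apply]
      by_cases h : e ∈ 𝓕.flat i <;> by_cases h' : e ∈ 𝓕.flat j <;> simp [h, h', hne]
    rw [this]
    refine M.comp_mem _ ?_ _ (M.neg_mem _ (hT.2 j))
    rcases le_total i j with h | h
    · rw [Set.union_eq_self_of_subset_left (𝓕.mono h)]; exact hT.2 j
    · rw [Set.union_eq_self_of_subset_right (𝓕.mono h)]; exact hT.2 i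

/-- `T_𝓕` is stable under translations by vectors in the span of the `f_i`. -/
theorem span_mul_mem {u : E → ZMod 2} (hu : u ∈ Submodule.span (ZMod 2) (Set.range 𝓕.flatVec)) :
    ∀ {T : E → SignType}, T ∈ 𝓕.topes → signVec u * T ∈ 𝓕.topes := by
  induction hu using Submodule.span_induction with
  | mem x hx => obtain ⟨i, rfl⟩ := hx; exact fun hT => 𝓕.flatVec_mul_mem hT i
  | zero => intro T hT; rwa [signVec_zero, one_mul]
  | add x y _ _ hx hy => intro T hT; rw [signVec_add, mul_assoc]; exact hx (hy hT)
  | smul a x _ hx =>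
    intro T hT
    have ha : ∀ a : ZMod 2, a = 0 ∨ a = 1 := by decide
    rcases ha a with rfl | rfl
    · rwa [zero_smul, signVec_zero, one_mul]
    · rw [one_smul]; exact hx hT

/-- Two topes in `T_𝓕` that differ somewhere on a block of the flag are opposite on that block. -/
theorem eq_neg_on_block {T T' : E → SignType} (hT : T ∈ 𝓕.topes) (hT' : T' ∈ 𝓕.topes)
    (i : Fin 𝓕.length) {e : E} (he : e ∈ 𝓕.flat i.succ) (he' : e ∉ 𝓕.flat i.castSucc)
    (hne : T e ≠ T' e) {f : E} (hf : f ∈ 𝓕.flat i.succ) (hf' : f ∉ 𝓕.flat i.castSucc) :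
    T' f = - T f := by
  have nz := 𝓕.ne_zero_of_isTope hT.1
  have nz' := 𝓕.ne_zero_of_isTope hT'.1
  have key : ∀ a b : SignType, a ≠ 0 → b ≠ 0 → a ≠ b → b = -a := by decide
  by_contra hcon
  obtain ⟨Z, hZ, hZe, hZf⟩ := M.elimination _ (hT.2 i.castSucc) _ (hT'.2 i.castSucc) e
    ⟨by simpa [signDelete, he'] using nz e,
      by simpa [signDelete, he'] using key _ _ (nz e) (nz' e) hne⟩
  have hfZ : Z f ≠ 0 := by
    rw [hZf f (fun h => hcon (by simpa [signDelete, hf'] using h.2))]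
    simp [signComp, signDelete, hf', nz]
  have h0 : ∀ g ∈ 𝓕.flat i.castSucc, Z g = 0 := by
    intro g hg
    rw [hZf g (fun h => h.1 (by simp [signDelete, hg]))]
    simp [signComp, signDelete, hg]
  have hW := M.comp_mem _ (hT.2 i.succ) _ hZ
  rcases 𝓕.saturated i {g | signComp (signDelete T (𝓕.flat i.succ)) Z g = 0} ⟨_, hW, rfl⟩
    (fun g hg => by
      have := (𝓕.ssubset i).subset hg
      simp [signComp, signDelete, this, h0 g hg])
    (fun g hg => by
      by_contra hg'
      simp [signComp, signDelete, hg', nz] at hg) with h | h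
  · apply he'
    rw [← h]
    simp [signComp, signDelete, he, hZe]
  · have : f ∈ {g | signComp (signDelete T (𝓕.flat i.succ)) Z g = 0} := by rw [h]; exact hf
    simp [signComp, signDelete, hf] at this
    exact hfZ this

/-- Two topes in `T_𝓕` differ by a vector in the span of the `f_i`. -/
theorem exists_span {T' : E → SignType} (hT' : T' ∈ 𝓕.topes) (i : Fin (𝓕.length + 1)) :
    ∀ {T : E → SignType}, T ∈ 𝓕.topes → (∀ e, T e ≠ T' e → e ∈ 𝓕.flat i) →
      ∃ u ∈ Submodule.span (ZMod 2) (Set.range 𝓕.flatVec), T' = signVec u * T := by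
  induction i using Fin.induction with
  | zero =>
    intro T hT h
    refine ⟨0, Submodule.zero_mem _, ?_⟩
    rw [signVec_zero, one_mul]
    funext e
    by_contra hne
    have := h e (Ne.symm hne)
    rw [𝓕.flat_zero] at this
    exact this
  | succ i ih =>
    intro T hT h
    by_cases hex : ∃ e, T e ≠ T' e ∧ e ∉ 𝓕.flat i.castSucc
    · obtain ⟨e, hne, he'⟩ := hex
      have hflip := 𝓕.flatVec_mul_mem hT i.succ
      obtain ⟨u, hu, hTu⟩ := ih hflip (fun g hg => by
        by_contra hg'
        apply hg
        rw [signVec_flatVec]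
        by_cases hgs : g ∈ 𝓕.flat i.succ
        · rw [if_pos hgs]
          exact (𝓕.eq_neg_on_block hT hT' i (h e hne) he' hne hgs hg').symm
        · rw [if_neg hgs]
          by_contra hgne
          exact hgs (h g hgne))
      refine ⟨u + 𝓕.flatVec i.succ, Submodule.add_mem _ hu (Submodule.subset_span ⟨_, rfl⟩), ?_⟩
      rw [signVec_add, mul_assoc]
      exact hTu
    · push Not at hex
      exact ih hT hex

/-- The vector space obtained from the affine space `T_𝓕` by choosing the origin `T₀ ∈ T_𝓕`:
it consists of the vectors `u` such that the translate `T_u * T₀` is in `T_𝓕`. -/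
def tangent (T₀ : 𝓕.topes) : Submodule (ZMod 2) (E → ZMod 2) where
  carrier := {u | signVec u * T₀.1 ∈ 𝓕.topes}
  zero_mem' := by
    change signVec 0 * T₀.1 ∈ 𝓕.topes
    rw [signVec_zero, one_mul]; exact T₀.2
  add_mem' := by
    intro u v hu hv
    obtain ⟨w, hw, hvw⟩ := 𝓕.exists_span hv (Fin.last _) T₀.2 (fun e _ => by
      rw [𝓕.flat_last]; trivial)
    change signVec (u + v) * T₀.1 ∈ 𝓕.topes
    rw [signVec_add, mul_assoc, hvw, mul_left_comm]
    exact 𝓕.span_mul_mem hw hu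
  smul_mem' := by
    intro a u hu
    have ha : ∀ a : ZMod 2, a = 0 ∨ a = 1 := by decide
    rcases ha a with rfl | rfl
    · change signVec ((0 : ZMod 2) • u) * T₀.1 ∈ 𝓕.topes
      rw [zero_smul, signVec_zero, one_mul]; exact T₀.2
    · change signVec ((1 : ZMod 2) • u) * T₀.1 ∈ 𝓕.topes
      rwa [one_smul]

theorem blockVec_mem_span (i : Fin 𝓕.length) :
    𝓕.blockVec i ∈ Submodule.span (ZMod 2) (Set.range 𝓕.flatVec) := by
  have : 𝓕.blockVec i = 𝓕.flatVec i.succ + 𝓕.flatVec i.castSucc := by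
    funext e
    have h11 : (1 : ZMod 2) + 1 = 0 := rfl
    by_cases h : e ∈ 𝓕.flat i.castSucc
    · have h' : e ∈ 𝓕.flat i.succ := (𝓕.ssubset i).subset h
      simp [blockVec, flatVec, h, h', h11]
    · by_cases h' : e ∈ 𝓕.flat i.succ <;> simp [blockVec, flatVec, h, h']
  rw [this]
  exact Submodule.add_mem _ (Submodule.subset_span ⟨_, rfl⟩) (Submodule.subset_span ⟨_, rfl⟩)

theorem sum_blockVec_mem_tangent (T₀ : 𝓕.topes) (A : Finset (Fin 𝓕.length)) :
    ∑ i ∈ A, 𝓕.blockVec i ∈ 𝓕.tangent T₀ :=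
  𝓕.span_mul_mem (Submodule.sum_mem _ fun i _ => 𝓕.blockVec_mem_span i) T₀.2

/-- The bijection from the vector space `tangent T₀` to `T_𝓕`, regarded as a map to the topes
of `M`: it sends `u` to `T_u * T₀`. -/
def translate (T₀ : 𝓕.topes) (u : 𝓕.tangent T₀) : M.Tope :=
  ⟨signVec u.1 * T₀.1, u.2.1⟩

/-- The affine coordinate chain of the affine coordinate subspace `U` through `T₀ = T_v` that is
parallel to the span of the `d_i` with `i ∈ S`, with `T₀` as origin: the sum over all
`u = v + ∑_{i ∈ A} d_i`, `A ⊆ S`, of `(-1) ^ |A| T_u`, where `|A|` is the weight of `u + v` with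
respect to the basis `(d_i)_{i ∈ S}`. -/
def coordChain (T₀ : 𝓕.topes) (S : Finset (Fin 𝓕.length)) : M.TopeSpace ℤ :=
  ∑ A ∈ S.powerset, Finsupp.single
    (𝓕.translate T₀ ⟨∑ i ∈ A, 𝓕.blockVec i, 𝓕.sum_blockVec_mem_tangent T₀ A⟩) ((-1) ^ A.card)

end CompleteFlag

/-! ### The dual Varchenko--Gelfand filtration -/

variable (M)

open Classical in
/-- The Heaviside function `h_e`, an element of the ring of integer valued functions on the
topes (that is, of linear functionals on the tope space, with pointwise multiplication). -/
def heaviside (e : E) : M.Tope → ℤ := fun T => if T.1 e = 1 then 1 else 0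

/-- The integer valued functions on the topes of degree less than `p`, i.e. at most `p - 1`:
those represented by a polynomial of total degree at most `p - 1` in the Heaviside functions,
and only the zero function for `p = 0`. -/
def degreeLT : ℕ → Submodule ℤ (M.Tope → ℤ)
  | 0 => ⊥
  | p + 1 => (MvPolynomial.restrictTotalDegree E ℤ p).map
      (MvPolynomial.aeval M.heaviside).toLinearMap

/-- The `p`-th piece of the dual degree filtration: the chains `γ` in the integral tope space with
`f(γ) = 0` for every function `f` of degree at most `p - 1`. -/
def dualDegree (p : ℕ) : Submodule ℤ (M.TopeSpace ℤ) :=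
  ⨅ f ∈ M.degreeLT p, LinearMap.ker (Finsupp.linearCombination ℤ f)

/-- The mod 2 reduction of the `p`-th piece of the dual degree filtration. -/
def dualDegreeModTwo (p : ℕ) : Submodule (ZMod 2) (M.TopeSpace (ZMod 2)) :=
  AddSubgroup.toZModSubmodule 2 ((M.dualDegree p).toAddSubgroup.map
    (Finsupp.mapRange.addMonoidHom (Int.castAddHom (ZMod 2))))

end OrientedMatroid

/-! ### The Quillen filtration -/

section Quillen

variable (V : Type*) [AddCommGroup V]

/-- The augmentation ideal of the group algebra of `V` over the field with two elements. -/
def augmentationIdeal : Ideal (AddMonoidAlgebra (ZMod 2) V) :=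
  RingHom.ker (AddMonoidAlgebra.lift (ZMod 2) (ZMod 2) V 1)

theorem mem_augmentationIdeal (t : AddMonoidAlgebra (ZMod 2) V) :
    t ∈ augmentationIdeal V ↔ t.coeff.sum (fun _ a => a) = 0 := by
  rw [augmentationIdeal, RingHom.mem_ker, AddMonoidAlgebra.lift_apply]
  simp

/-- The `p`-th piece of the Quillen filtration of the group algebra of `V`: the `p`-th power of the
augmentation ideal. -/
def quillenPiece (p : ℕ) : Submodule (ZMod 2) (AddMonoidAlgebra (ZMod 2) V) :=
  (augmentationIdeal V ^ p).restrictScalars (ZMod 2)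

variable {V}

/-- The element `γ_G`, the sum of all `T_v` with `v ∈ G`, for a (finite) subset `G` of `V`. -/
def gammaSum (G : Set V) : AddMonoidAlgebra (ZMod 2) V :=
  ∑ᶠ v ∈ G, AddMonoidAlgebra.single v 1

/-- The affine coordinate subspaces of dimension `p`, with respect to a basis `b`: the translates
of the subspaces spanned by `p` elements of the basis. -/
def affineCoordSubspaces [Module (ZMod 2) V] {ι : Type*} (b : Module.Basis ι (ZMod 2) V) (p : ℕ) :
    Set (Set V) :=
  {U | ∃ (v : V) (S : Finset ι), S.card = p ∧
    U = {u | ∃ w ∈ Submodule.span (ZMod 2) (b '' (S : Set ι)), u = v + w}}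

end Quillen

namespace OrientedMatroid

variable {E : Type*} (M : OrientedMatroid E)

/-- The `p`-th piece of the Quillen filtration of the tope space of `M` over the field with two
elements: the sum over all complete flags `𝓕` of the `p`-th pieces of the Quillen filtrations of
the affine spaces `T_𝓕`, which are regarded as vector spaces by choosing an origin
(the sum is taken over all choices of the origin; they all give the same summand). -/
def quillen (p : ℕ) : Submodule (ZMod 2) (M.TopeSpace (ZMod 2)) :=
  ⨆ (𝓕 : M.CompleteFlag) (T₀ : 𝓕.topes),
    (quillenPiece (𝓕.tangent T₀) p).map
      (Finsupp.lmapDomain (ZMod 2) (ZMod 2) (𝓕.translate T₀) ∘ₗ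
        (AddMonoidAlgebra.coeffLinearEquiv (ZMod 2)).toLinearMap)

end OrientedMatroid

end

/-! Everything rests on the products T_v ∏_{i ∈ S} (1 + T_(b i)), called `cubeProd`. If b spans V,
the elements 1 + T_(b i) generate the augmentation ideal, and (1 + T_u)² = 0 kills repeated factors.
Hence the p-th power of the ideal is spanned over F_2 by the products with |S| = p
(`quillenPiece_le_span_cubeProd`). If b is linearly independent, such a product is γ_U for the
affine subspace U through v with directions S (`gammaSum_translate_span`). Conversely γ_{V'} is the
product for a basis of V', so it lies in the power of exponent dim V'.

For a flag of flats the block vectors span the tangent space, and the products are the mod 2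
reductions of the integral coordinate chains (`map_cubeProd`). Both claims about topes therefore
reduce to `coordChain_mem_dualDegree`. A monomial of degree less than p in the Heaviside functions
involves fewer than p elements of E. The p blocks indexed by S are disjoint, so the monomial misses
one of them. Flipping the signs on that block pairs the terms of the chain with equal values and
opposite coefficients, and the sum vanishes. -/

noncomputable section

/-! ### Powers of the augmentation ideal -/

section Quillen

variable {V : Type*} [AddCommGroup V]

open AddMonoidAlgebra in
/-- The product of the elements `1 + T_(b i)` over `i ∈ S`, translated by `v`. -/
def cubeProd {ι : Type*} (b : ι → V) (v : V) (S : Finset ι) : AddMonoidAlgebra (ZMod 2) V :=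
  single v 1 * ∏ i ∈ S, (1 + single (b i) 1)

open AddMonoidAlgebra in
theorem prod_single_one {ι : Type*} (b : ι → V) (A : Finset ι) :
    ∏ i ∈ A, (single (b i) 1 : AddMonoidAlgebra (ZMod 2) V) = single (∑ i ∈ A, b i) 1 := by
  classical
  induction A using Finset.induction_on with
  | empty => simp [one_def]
  | insert a s ha ih => rw [Finset.prod_insert ha, Finset.sum_insert ha, ih, single_mul_single, one_mul]

open AddMonoidAlgebra in
theorem cubeProd_eq_sum {ι : Type*} (b : ι → V) (v : V) (S : Finset ι) :
    cubeProd b v S = ∑ A ∈ S.powerset, single (v + ∑ i ∈ A, b i) 1 := by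
  classical
  rw [cubeProd, Finset.prod_one_add, Finset.mul_sum]
  refine Finset.sum_congr rfl fun A _ => ?_
  rw [prod_single_one, single_mul_single, one_mul]

open AddMonoidAlgebra in
theorem one_add_single_mem_augmentationIdeal (u : V) :
    (1 + single u 1 : AddMonoidAlgebra (ZMod 2) V) ∈ augmentationIdeal V := by
  rw [augmentationIdeal, RingHom.mem_ker]
  simp
  rfl

theorem cubeProd_mem_quillenPiece {ι : Type*} (b : ι → V) (v : V) (S : Finset ι) :
    cubeProd b v S ∈ quillenPiece V S.card := by
  refine Ideal.mul_mem_left _ _ ?_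
  rw [← Finset.prod_const]
  exact Ideal.prod_mem_prod fun i _ => one_add_single_mem_augmentationIdeal (b i)

instance charP_addMonoidAlgebra : CharP (AddMonoidAlgebra (ZMod 2) V) 2 :=
  charP_of_injective_algebraMap (algebraMap (ZMod 2) _).injective 2

variable [Module (ZMod 2) V]

-- Let J be the ideal on the right. The u with T_u - 1 ∈ J are closed under addition because T_(x+y)
-- - 1 = T_x (T_y - 1) + (T_x - 1), so they fill the span of b. Every t is then congruent modulo J
-- to its augmentation, which is zero on the augmentation ideal.
open AddMonoidAlgebra in
theorem augmentationIdeal_le_span {ι : Type*} {b : ι → V}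
    (hb : Submodule.span (ZMod 2) (Set.range b) = ⊤) :
    augmentationIdeal V ≤ Ideal.span (Set.range fun i => 1 + single (b i) (1 : ZMod 2)) := by
  set J : Ideal (AddMonoidAlgebra (ZMod 2) V) :=
    Ideal.span (Set.range fun i => 1 + single (b i) (1 : ZMod 2)) with hJ
  have h1 : ∀ u : V, single u (1 : ZMod 2) - 1 ∈ J := by
    intro u
    have hu : u ∈ Submodule.span (ZMod 2) (Set.range b) := hb ▸ Submodule.mem_top
    induction hu using Submodule.span_induction with
    | mem x hx =>
      obtain ⟨i, rfl⟩ := hx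
      have h : single (b i) (1 : ZMod 2) - 1 = 1 + single (b i) (1 : ZMod 2) := by
        rw [sub_eq_add_neg, add_comm, CharTwo.neg_eq]
      rw [h]
      exact Ideal.subset_span ⟨i, rfl⟩
    | zero => rw [← one_def, sub_self]; exact J.zero_mem
    | add x y _ _ hx hy =>
      have : single (x + y) (1 : ZMod 2) - 1 =
          single x 1 * (single y (1 : ZMod 2) - 1) + (single x 1 - 1) := by
        rw [mul_sub, single_mul_single, one_mul, mul_one]; abel
      rw [this]
      exact J.add_mem (J.mul_mem_left _ hy) hx
    | smul a x _ hx =>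
      have ha : ∀ a : ZMod 2, a = 0 ∨ a = 1 := by decide
      rcases ha a with rfl | rfl
      · rw [zero_smul, ← one_def, sub_self]; exact J.zero_mem
      · rwa [one_smul]
  have h2 : ∀ t : AddMonoidAlgebra (ZMod 2) V,
      t - algebraMap (ZMod 2) _ (AddMonoidAlgebra.lift (ZMod 2) (ZMod 2) V 1 t) ∈ J := by
    intro t
    induction t using AddMonoidAlgebra.induction_linear with
    | zero => simp
    | add f g hf hg =>
      rw [map_add, map_add, add_sub_add_comm]; exact J.add_mem hf hg
    | single u r =>
      have : single u r - algebraMap (ZMod 2) (AddMonoidAlgebra (ZMod 2) V)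
          (AddMonoidAlgebra.lift (ZMod 2) (ZMod 2) V 1 (single u r)) =
          algebraMap (ZMod 2) _ r * (single u (1 : ZMod 2) - 1) := by
        rw [mul_sub, mul_one, ← Algebra.smul_def]
        simp
      rw [this]
      exact J.mul_mem_left _ (h1 u)
  intro t ht
  have := h2 t
  rw [augmentationIdeal, RingHom.mem_ker] at ht
  have ht' : AddMonoidAlgebra.lift (ZMod 2) (ZMod 2) V 1 t = 0 := ht
  rwa [ht', map_zero, sub_zero] at this

-- In characteristic two the square is 1 + T_(2u), and 2u = 0. This is why only products of distinct
-- generators survive in the powers of the ideal.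
open AddMonoidAlgebra in
theorem one_add_single_mul_self (u : V) :
    (1 + single u 1 : AddMonoidAlgebra (ZMod 2) V) * (1 + single u 1) = 0 := by
  have h : u + u = 0 := by
    rw [← two_smul (ZMod 2) u, show (2 : ZMod 2) = 0 from rfl, zero_smul]
  rw [CharTwo.add_mul_self, one_mul, single_mul_single, h, one_mul, ← one_def,
    CharTwo.add_self_eq_zero]

open AddMonoidAlgebra in
theorem augmentationIdeal_pow_le_span {ι : Type*} {b : ι → V}
    (hb : Submodule.span (ZMod 2) (Set.range b) = ⊤) (p : ℕ) :
    augmentationIdeal V ^ p ≤ Ideal.span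
      ((fun S : Finset ι => ∏ i ∈ S, (1 + single (b i) (1 : ZMod 2))) '' {S | S.card = p}) := by
  classical
  induction p with
  | zero =>
    rw [pow_zero]
    have h : (1 : AddMonoidAlgebra (ZMod 2) V) ∈ Ideal.span
        ((fun S : Finset ι => ∏ i ∈ S, (1 + single (b i) (1 : ZMod 2))) '' {S | S.card = 0}) :=
      Ideal.subset_span ⟨∅, rfl, Finset.prod_empty⟩
    rw [(Ideal.eq_top_iff_one _).2 h]
    exact le_top
  | succ p ih =>
    rw [pow_succ]
    refine (Ideal.mul_mono ih (augmentationIdeal_le_span hb)).trans ?_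
    rw [Ideal.span_mul_span', Ideal.span_le]
    rintro _ ⟨_, ⟨S, hS, rfl⟩, _, ⟨i, rfl⟩, rfl⟩
    -- A repeated factor gives zero; a new one enlarges S by one index.
    by_cases hi : i ∈ S
    · have : (∏ i ∈ S, (1 + single (b i) (1 : ZMod 2))) * (1 + single (b i) (1 : ZMod 2)) = 0 := by
        rw [← Finset.prod_erase_mul _ _ hi, mul_assoc, one_add_single_mul_self, mul_zero]
      simp only [SetLike.mem_coe]
      rw [this]
      exact Submodule.zero_mem _
    · refine Ideal.subset_span ⟨insert i S, ?_, ?_⟩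
      · simpa [Finset.card_insert_of_notMem hi] using hS
      · simp only
        rw [Finset.prod_insert hi, mul_comm]

open AddMonoidAlgebra in
/-- The `p`-th power of the augmentation ideal is spanned by the translated products of `p`
distinct elements `1 + T_(b i)`, for any family `b` that spans `V`. -/
theorem quillenPiece_le_span_cubeProd {ι : Type*} {b : ι → V}
    (hb : Submodule.span (ZMod 2) (Set.range b) = ⊤) (p : ℕ) :
    quillenPiece V p ≤ Submodule.span (ZMod 2)
      {x | ∃ (v : V) (S : Finset ι), S.card = p ∧ x = cubeProd b v S} := by
  intro t ht
  have h := augmentationIdeal_pow_le_span hb p ht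
  refine Submodule.span_induction ?_ (Submodule.zero_mem _)
    (fun x y _ _ hx hy => Submodule.add_mem _ hx hy) ?_ h
  · rintro _ ⟨S, hS, rfl⟩
    refine Submodule.subset_span ⟨0, S, hS, ?_⟩
    rw [cubeProd, ← one_def, one_mul]
  -- To pass from an ideal span to an F_2-span, expand the multiplier r into group elements: each of
  -- them only moves the base point of the product.
  · intro r x _ hx
    refine Submodule.span_induction ?_ (by simp)
      (fun y z _ _ hy hz => by rw [smul_add]; exact Submodule.add_mem _ hy hz)
      (fun a y _ hy => by rw [smul_comm]; exact Submodule.smul_mem _ _ hy) hx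
    rintro _ ⟨v, S, hS, rfl⟩
    induction r using AddMonoidAlgebra.induction_linear with
    | zero => simp
    | add f g hf hg => rw [add_smul]; exact Submodule.add_mem _ hf hg
    | single u r =>
      have : (single u r : AddMonoidAlgebra (ZMod 2) V) • cubeProd b v S =
          r • cubeProd b (u + v) S := by
        rw [smul_eq_mul, cubeProd, cubeProd, ← mul_assoc, single_mul_single, ← smul_mul_assoc]
        simp
      rw [this]
      exact Submodule.smul_mem _ _ (Submodule.subset_span ⟨_, S, hS, rfl⟩)

/-! ### Affine coordinate subspaces and the chains γ_U -/

/-- Equal sums make the difference of the two indicator functions a linear relation. -/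
theorem injective_sum_of_linearIndependent {ι : Type*} {b : ι → V}
    (hb : LinearIndependent (ZMod 2) b) :
    Function.Injective fun A : Finset ι => ∑ i ∈ A, b i := by
  classical
  intro A B hAB
  have key := linearIndependent_iff'.1 hb (A ∪ B)
    (fun i => (if i ∈ A then 1 else 0) - (if i ∈ B then 1 else 0)) (by
      simp only [sub_smul, Finset.sum_sub_distrib, ite_smul, one_smul, zero_smul]
      rw [Finset.sum_ite_mem, Finset.sum_ite_mem, Finset.union_inter_cancel_left,
        Finset.union_inter_cancel_right, sub_eq_zero]
      exact hAB)
  ext i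
  by_cases hA : i ∈ A <;> by_cases hB : i ∈ B
  · simp [hA, hB]
  · simpa [hA, hB] using key i (by simp [hA])
  · simpa [hA, hB] using key i (by simp [hB])
  · simp [hA, hB]

/-- Coefficients in F_2 are 0 or 1, so a linear combination is the sum over the subset where the
coefficient is 1. -/
theorem mem_span_image_iff_exists_sum {ι : Type*} (b : ι → V) (S : Finset ι) (w : V) :
    w ∈ Submodule.span (ZMod 2) (b '' (S : Set ι)) ↔ ∃ A ∈ S.powerset, ∑ i ∈ A, b i = w := by
  classical
  constructor
  · intro hw
    rw [Submodule.mem_span_image_finset_iff_exists_fun] at hw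
    obtain ⟨c, rfl⟩ := hw
    refine ⟨(S.attach.filter fun i => c i = 1).map (Function.Embedding.subtype _), ?_, ?_⟩
    · refine Finset.mem_powerset.2 fun i hi => ?_
      obtain ⟨j, _, rfl⟩ := Finset.mem_map.1 hi
      exact j.2
    rw [Finset.sum_map, Finset.sum_filter, Finset.univ_eq_attach]
    refine Finset.sum_congr rfl fun i _ => ?_
    have ha : ∀ a : ZMod 2, a = 0 ∨ a = 1 := by decide
    rcases ha (c i) with h | h <;> simp [h]
  · rintro ⟨A, hA, rfl⟩
    exact Submodule.sum_mem _ fun i hi =>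
      Submodule.subset_span ⟨i, Finset.mem_powerset.1 hA hi, rfl⟩

/-- For an affine subspace parallel to the span of linearly independent vectors, `γ_U` is a
translated product of elements `1 + T_(b i)`. -/
theorem gammaSum_translate_span {ι : Type*} {b : ι → V} (hb : LinearIndependent (ZMod 2) b)
    (v : V) (S : Finset ι) :
    gammaSum {u | ∃ w ∈ Submodule.span (ZMod 2) (b '' (S : Set ι)), u = v + w} =
      cubeProd b v S := by
  classical
  have himage : {u | ∃ w ∈ Submodule.span (ZMod 2) (b '' (S : Set ι)), u = v + w} =
      (fun A : Finset ι => v + ∑ i ∈ A, b i) '' (S.powerset : Set (Finset ι)) := by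
    ext u
    constructor
    · rintro ⟨w, hw, rfl⟩
      obtain ⟨A, hA, rfl⟩ := (mem_span_image_iff_exists_sum b S w).1 hw
      exact ⟨A, hA, rfl⟩
    · rintro ⟨A, hA, rfl⟩
      exact ⟨_, (mem_span_image_iff_exists_sum b S _).2 ⟨A, hA, rfl⟩, rfl⟩
  -- No two subsets give the same point, so each point of U occurs exactly once in the expanded
  -- product and nothing cancels mod 2.
  have hinj : Function.Injective fun A : Finset ι => v + ∑ i ∈ A, b i :=
    (add_right_injective v).comp (injective_sum_of_linearIndependent hb)
  rw [gammaSum, himage, finsum_mem_image hinj.injOn, finsum_mem_coe_finset, cubeProd_eq_sum]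

theorem quillenPiece_le_span_gammaSum {ι : Type*} (b : Module.Basis ι (ZMod 2) V) (p : ℕ) :
    quillenPiece V p ≤ Submodule.span (ZMod 2) (gammaSum '' affineCoordSubspaces b p) := by
  refine (quillenPiece_le_span_cubeProd b.span_eq p).trans (Submodule.span_mono ?_)
  rintro _ ⟨v, S, hS, rfl⟩
  exact ⟨_, ⟨v, S, hS, rfl⟩, gammaSum_translate_span b.linearIndependent v S⟩

/-- Any basis of V' writes γ_{V'} as a product of dim V' elements of the augmentation ideal. It need
not be related to a basis of V, since the ideal power does not depend on one. -/
theorem gammaSum_submodule_mem_quillenPiece (V' : Submodule (ZMod 2) V)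
    [Module.Finite (ZMod 2) V'] :
    gammaSum (V' : Set V) ∈ quillenPiece V (Module.finrank (ZMod 2) V') := by
  have c := Module.finBasis (ZMod 2) V'
  have hc : LinearIndependent (ZMod 2) (fun i => (c i : V)) :=
    c.linearIndependent.map' V'.subtype V'.ker_subtype
  have hspan : Submodule.span (ZMod 2) (Set.range fun i => (c i : V)) = V' := by
    have := congrArg (Submodule.map V'.subtype) c.span_eq
    rwa [Submodule.map_span, ← Set.range_comp, Submodule.map_top, Submodule.range_subtype] at this
  have h := gammaSum_translate_span hc 0 Finset.univ
  simp only [Finset.coe_univ, Set.image_univ, hspan, zero_add, exists_eq_right'] at h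
  have h' := cubeProd_mem_quillenPiece (fun i => (c i : V)) 0 Finset.univ
  rw [← h, Finset.card_univ, Fintype.card_fin] at h'
  exact h'

end Quillen

namespace OrientedMatroid

variable {E : Type*} {M : OrientedMatroid E}

namespace CompleteFlag

variable (𝓕 : M.CompleteFlag)

/-! ### The block vectors of a flag -/

theorem blockVec_disjoint {i j : Fin 𝓕.length} {e : E} (hi : 𝓕.blockVec i e ≠ 0)
    (hj : 𝓕.blockVec j e ≠ 0) : i = j := by
  have key : ∀ {i j : Fin 𝓕.length}, 𝓕.blockVec i e ≠ 0 → 𝓕.blockVec j e ≠ 0 → ¬ i < j := by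
    intro i j hi hj hij
    simp only [blockVec, ne_eq, ite_eq_right_iff, Classical.not_imp] at hi hj
    exact hj.1.2 (𝓕.mono (Fin.succ_le_castSucc_iff.2 hij) hi.1.1)
  exact le_antisymm (not_lt.1 (key hj hi)) (not_lt.1 (key hi hj))

/-- Telescoping: each flat of the flag is the disjoint union of the blocks below it. -/
theorem flatVec_mem_span_blockVec (i : Fin (𝓕.length + 1)) :
    𝓕.flatVec i ∈ Submodule.span (ZMod 2) (Set.range 𝓕.blockVec) := by
  induction i using Fin.induction with
  | zero =>
    have : 𝓕.flatVec 0 = 0 := by funext e; simp [flatVec, 𝓕.flat_zero]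
    rw [this]; exact Submodule.zero_mem _
  | succ i ih =>
    have : 𝓕.flatVec i.succ = 𝓕.flatVec i.castSucc + 𝓕.blockVec i := by
      funext e
      by_cases h : e ∈ 𝓕.flat i.castSucc
      · simp [blockVec, flatVec, h, (𝓕.ssubset i).subset h]
      · by_cases h' : e ∈ 𝓕.flat i.succ <;> simp [blockVec, flatVec, h, h']
    rw [this]
    exact Submodule.add_mem _ ih (Submodule.subset_span ⟨i, rfl⟩)

theorem signVec_mul_right_cancel {u w : E → ZMod 2} {T : E → SignType} (hT : ∀ e, T e ≠ 0)
    (h : signVec u * T = signVec w * T) : u = w := by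
  funext e
  have key : ∀ (a b : ZMod 2) (s : SignType), s ≠ 0 →
      (-1 : SignType) ^ a.val * s = (-1) ^ b.val * s → a = b := by decide
  exact key _ _ _ (hT e) (congrFun h e)

theorem tangent_le_span_blockVec (T₀ : 𝓕.topes) :
    𝓕.tangent T₀ ≤ Submodule.span (ZMod 2) (Set.range 𝓕.blockVec) := by
  intro u hu
  obtain ⟨w, hw, huw⟩ := 𝓕.exists_span (T' := signVec u * T₀.1) hu (Fin.last _) T₀.2
    (fun e _ => by rw [𝓕.flat_last]; trivial)
  rw [signVec_mul_right_cancel (𝓕.ne_zero_of_isTope T₀.2.1) huw]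
  refine Submodule.span_le.2 ?_ hw
  rintro _ ⟨i, rfl⟩
  exact 𝓕.flatVec_mem_span_blockVec i

/-- The block vector `d_i` as an element of the tangent space of `T_𝓕`. -/
def tangentBlockVec (T₀ : 𝓕.topes) (i : Fin 𝓕.length) : 𝓕.tangent T₀ :=
  ⟨𝓕.blockVec i, 𝓕.span_mul_mem (𝓕.blockVec_mem_span i) T₀.2⟩

/-- Spanning is all that is needed to describe the Quillen pieces by products; independence of the
block vectors plays no role. -/
theorem span_range_tangentBlockVec (T₀ : 𝓕.topes) :
    Submodule.span (ZMod 2) (Set.range (𝓕.tangentBlockVec T₀)) = ⊤ := by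
  apply Submodule.map_injective_of_injective (𝓕.tangent T₀).subtype_injective
  rw [Submodule.map_span, ← Set.range_comp, Submodule.map_top, Submodule.range_subtype]
  refine le_antisymm (Submodule.span_le.2 ?_) (𝓕.tangent_le_span_blockVec T₀)
  rintro _ ⟨i, rfl⟩
  exact (𝓕.tangentBlockVec T₀ i).2

/-! ### Coordinate chains lie in the dual degree filtration -/

/-- Pigeonhole: the blocks are disjoint, so an element of m meets at most one of them. -/
theorem exists_blockVec_eq_zero {S : Finset (Fin 𝓕.length)} {m : Finset E}
    (h : m.card < S.card) : ∃ i ∈ S, ∀ e ∈ m, 𝓕.blockVec i e = 0 := by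
  by_contra! hcon
  have : Nonempty E :=
    let ⟨i, hi⟩ := Finset.card_pos.1 (Nat.zero_lt_of_lt h)
    let ⟨e, _⟩ := hcon i hi
    ⟨e⟩
  choose! f hf using hcon
  refine absurd (Finset.card_le_card_of_injOn f (fun i hi => (hf i hi).1) ?_) (not_le.2 h)
  intro i hi j hj hij
  exact 𝓕.blockVec_disjoint (hf i hi).2 (hij ▸ (hf j hj).2)

/-- A function of the topes that does not depend on the `i`-th block vanishes on the coordinate
chains in whose direction `i` occurs. -/
theorem sum_powerset_eq_zero (T₀ : 𝓕.topes) {S : Finset (Fin 𝓕.length)} {i : Fin 𝓕.length}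
    (hi : i ∈ S) (m : E →₀ ℕ) (hm : ∀ e ∈ m.support, 𝓕.blockVec i e = 0) :
    ∑ A ∈ S.powerset, (-1 : ℤ) ^ A.card * ∏ e ∈ m.support, M.heaviside e
      (𝓕.translate T₀ ⟨∑ i ∈ A, 𝓕.blockVec i, 𝓕.sum_blockVec_mem_tangent T₀ A⟩) ^ m e = 0 := by
  classical
  obtain ⟨S, hi', rfl⟩ : ∃ S' : Finset (Fin 𝓕.length), i ∉ S' ∧ S = insert i S' :=
    ⟨S.erase i, Finset.notMem_erase i S, (Finset.insert_erase hi).symm⟩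
  -- Pair A with A ∪ {i}: the sign changes, while the monomial does not see block i.
  rw [Finset.sum_powerset_insert hi', ← Finset.sum_add_distrib]
  refine Finset.sum_eq_zero fun A hA => ?_
  have hiA : i ∉ A := fun h => hi' (Finset.mem_powerset.1 hA h)
  rw [Finset.card_insert_of_notMem hiA, pow_succ, mul_neg_one, neg_mul, ← sub_eq_add_neg,
    sub_eq_zero]
  congr 1
  refine Finset.prod_congr rfl fun e he => ?_
  congr 1
  simp [heaviside, translate, signVec, Finset.sum_insert hiA, hm e he]

theorem coordChain_mem_dualDegree (T₀ : 𝓕.topes) (S : Finset (Fin 𝓕.length)) :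
    𝓕.coordChain T₀ S ∈ M.dualDegree S.card := by
  simp only [dualDegree, Submodule.mem_iInf, LinearMap.mem_ker]
  intro f hf
  obtain hS | ⟨p, hS⟩ : S.card = 0 ∨ ∃ p, S.card = p + 1 := by
    cases S.card <;> simp
  -- For p = 0 the only function to test is zero.
  · rw [hS] at hf
    rw [(Submodule.mem_bot ℤ).1 hf]
    simp
  rw [hS] at hf
  obtain ⟨q, hq, rfl⟩ := hf
  have hval : ∀ T : M.Tope, MvPolynomial.aeval M.heaviside q T =
      ∑ m ∈ q.support, q.coeff m * ∏ e ∈ m.support, M.heaviside e T ^ m e := by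
    intro T
    rw [MvPolynomial.aeval_def, MvPolynomial.eval₂_eq]
    simp [Finset.sum_apply, Finset.prod_apply]
  simp only [coordChain, map_sum, Finsupp.linearCombination_single, AlgHom.toLinearMap_apply,
    hval, smul_eq_mul, Finset.mul_sum]
  rw [Finset.sum_comm]
  refine Finset.sum_eq_zero fun m hm => ?_
  -- Every exponent on the support is at least 1, so the number of variables is at most the degree,
  -- which is at most |S| - 1.
  have hdeg : m.support.card < S.card := by
    rw [hS, Nat.lt_succ_iff]
    refine le_trans ?_ (((MvPolynomial.le_totalDegree hm)).trans
      ((MvPolynomial.mem_restrictTotalDegree E p q).1 hq))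
    rw [Finset.card_eq_sum_ones]
    exact Finset.sum_le_sum fun e he => Nat.one_le_iff_ne_zero.2 (Finsupp.mem_support_iff.1 he)
  obtain ⟨i, hi, hi0⟩ := 𝓕.exists_blockVec_eq_zero hdeg
  simp only [mul_left_comm _ (q.coeff m), ← Finset.mul_sum]
  rw [𝓕.sum_powerset_eq_zero T₀ hi m hi0, mul_zero]

/-! ### Reduction mod 2 and comparison of the filtrations -/

/-- Modulo two, the coordinate chain through `T_v` is the image of the translate by `v` of the
product of the elements `1 + T_(d_i)`. -/
theorem map_cubeProd (T₀ : 𝓕.topes) (v : 𝓕.tangent T₀) (S : Finset (Fin 𝓕.length)) :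
    Finsupp.lmapDomain (ZMod 2) (ZMod 2) (𝓕.translate T₀)
      (AddMonoidAlgebra.coeffLinearEquiv (ZMod 2) (cubeProd (𝓕.tangentBlockVec T₀) v S)) =
    Finsupp.mapRange.addMonoidHom (Int.castAddHom (ZMod 2))
      (𝓕.coordChain ⟨signVec v.1 * T₀.1, v.2⟩ S) := by
  rw [cubeProd_eq_sum, coordChain]
  simp only [map_sum]
  refine Finset.sum_congr rfl fun A _ => ?_
  -- The translation by v is absorbed into the origin, which moves from T₀ to T_v * T₀.
  have h : 𝓕.translate T₀ (v + ∑ i ∈ A, 𝓕.tangentBlockVec T₀ i) =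
      𝓕.translate ⟨signVec v.1 * T₀.1, v.2⟩
        ⟨∑ i ∈ A, 𝓕.blockVec i, 𝓕.sum_blockVec_mem_tangent _ A⟩ := by
    apply Subtype.ext
    simp only [translate, Submodule.coe_add, AddSubmonoidClass.coe_finsetSum, tangentBlockVec,
      signVec_add]
    rw [mul_assoc, mul_left_comm]
  have h1 : ((-1 : ℤ) ^ A.card : ZMod 2) = 1 := by
    rw [show ((-1 : ℤ) : ZMod 2) = 1 from rfl, one_pow]
  simp [h]

end CompleteFlag

theorem quillen_le_dualDegreeModTwo (p : ℕ) : M.quillen p ≤ M.dualDegreeModTwo p := by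
  refine iSup_le fun 𝓕 => iSup_le fun T₀ => ?_
  refine (Submodule.map_mono
    (quillenPiece_le_span_cubeProd (𝓕.span_range_tangentBlockVec T₀) p)).trans ?_
  rw [Submodule.map_span, Submodule.span_le]
  rintro _ ⟨_, ⟨v, S, hS, rfl⟩, rfl⟩
  refine ⟨𝓕.coordChain ⟨signVec v.1 * T₀.1, v.2⟩ S, ?_, (𝓕.map_cubeProd T₀ v S).symm⟩
  subst hS
  exact 𝓕.coordChain_mem_dualDegree _ S

end OrientedMatroid

end

theorem mainTheorem7
    {E : Type*} [Finite E] (M : OrientedMatroid E) (hM : M.Loopless)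
    {V : Type*} [AddCommGroup V] [Module (ZMod 2) V] (d : ℕ)
    (b : Module.Basis (Fin d) (ZMod 2) V) (p : ℕ) :
    -- the Quillen filtration is contained in the mod 2 dual Varchenko-Gelfand filtration
    M.quillen p ≤ M.dualDegreeModTwo p ∧
    -- the integral affine coordinate chains of dimension `p` lie in the `p`-th integral piece
    (∀ (𝓕 : M.CompleteFlag) (T₀ : 𝓕.topes) (S : Finset (Fin 𝓕.length)), S.card = p →
      𝓕.coordChain T₀ S ∈ M.dualDegree p) ∧
    -- the chains of affine coordinate subspaces of dimension `p` span the `p`-th Quillen piece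
    quillenPiece V p ≤ Submodule.span (ZMod 2) (gammaSum '' affineCoordSubspaces b p) ∧
    (∀ V' : Submodule (ZMod 2) V, Module.finrank (ZMod 2) V' = p →
      gammaSum (V' : Set V) ∈
        Submodule.span (ZMod 2) (gammaSum '' affineCoordSubspaces b p)) := by
  refine ⟨OrientedMatroid.quillen_le_dualDegreeModTwo p, ?_, quillenPiece_le_span_gammaSum b p, ?_⟩
  · rintro 𝓕 T₀ S rfl
    exact 𝓕.coordChain_mem_dualDegree T₀ S
  · rintro V' rfl
    have : Module.Finite (ZMod 2) V := Module.Finite.of_basis b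
    -- The passage through the Quillen piece changes the adapted basis of V' into the given basis b.
    exact quillenPiece_le_span_gammaSum b _ (gammaSum_submodule_mem_quillenPiece V')
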